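/- Let $\tilde{\mathcal A}$ be the $b$-adically completed $\mathbb C$-algebra of series $\sum_{\nu\ge 0}P_\nu(a)b^\nu$, $P_\nu\in\mathbb C[x]$, with $ab-ba=b^2$. For $q\in\mathbb Q\cap\,]0,1]$ and $N\in\mathbb N$ let $\Xi^{(N)}_q=\bigoplus_{j=0}^N\mathbb C[[s]]\,s^{q-1}(\mathrm{Log}\,s)^j$, where $a$ acts as multiplication by $s$ and $b$ as the primitive in $s$ without constant; for finite $\Lambda\subset\mathbb Q\cap\,]0,1]$ let $\Xi^{(N)}_\Lambda=\bigoplus_{q\in\Lambda}\Xi^{(N)}_q$. A fresco is a left $\tilde{\mathcal A}$-module isomorphic to a submodule $\tilde{\mathcal A}\varphi\subset\Xi^{(N)}_\Lambda\otimes_{\mathbb C}V$ for some such $\Lambda$, $N$, some finite dimensional complex vector space $V$ and some $\varphi$. An (a,b)-module is an $\tilde{\mathcal A}$-module that is free of finite rank over $\mathbb C[[b]]$ (equivalently, a free $\mathbb C[[b]]$-module of finite rank with a $\mathbb C$-linear operator $a$ such that $aS=Sa+b^2S'$ for $S\in\mathbb C[[b]]$). It has a simple pole if $aM\subset bM$,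 and is regular if it embeds in an (a,b)-module with a simple pole. It is semi-simple if it is isomorphic to a submodule of a finite direct sum of regular (a,b)-modules of rank $1$. A submodule $F\subset E$ is normal if $F\cap bE=bF$. For $\lambda\in\mathbb C$ let $E_\lambda=\tilde{\mathcal A}/\tilde{\mathcal A}(a-\lambda b)$, which is free of rank $1$ over $\mathbb C[[b]]$. A Jordan–Hölder sequence of $E$ is a sequence $0=F_0\subset F_1\subset\dots\subset F_k=E$ of normal submodules with all quotients $F_j/F_{j-1}$ of rank $1$; its associated numbers are the $\lambda_j\in\mathbb C$ with $F_j/F_{j-1}\simeq E_{\lambda_j}$. Lemma. Let $E$ be a semi-simple fresco of rank $k$ and let $\lambda_1,\dots,\lambda_k$ be the numbers associated to a Jordan–Hölder sequence of $E$. Let $\mu_1,\dots,\mu_k$ be a twisted permutation of $\lambda_1,\dots,\lambda_k$, that is, the sequence $(\mu_j+j)_{1\le j\le k}$ is a permutation of the sequence $(\lambda_j+j)_{1\le j\le k}$. Then there exists a Jordan–Hölder sequence $0=G_0\subset G_1\subset\dots\subset G_k=E$ of $E$ with $G_j/G_{j-1}\simeq E_{\mu_j}$ for every $j\in\{1,\dots,k\}$.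 -/

import Mathlib

open PowerSeries TensorProduct

noncomputable section

namespace Fresco

universe u v

/-! ### `ℂ[[b]]`-modules with an operator `a`

The variable of `ℂ⟦X⟧` is `b`.  For modules of finite type over `ℂ[[b]]` such a structure is the
same thing as a left module over the `b`-adically completed algebra generated by `a` and `b` with
`a b - b a = b ^ 2`, and stable `ℂ[[b]]`-submodules are the same as submodules over this algebra. -/

/-- An additive operator `a` on a `ℂ[[b]]`-module with `a S = S a + b ^ 2 S'` for `S ∈ ℂ[[b]]`.
(With `S` constant, this says that `a` is `ℂ`-linear.) -/
class AModule (E : Type u) [AddCommGroup E] [Module ℂ⟦X⟧ E] where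
  /-- the operator `a` -/
  a : E →+ E
  a_smul : ∀ (S : ℂ⟦X⟧) (x : E), a (S • x) = S • a x + (X ^ 2 * derivative ℂ S) • x

/-- `E` and `E'` are isomorphic: a `ℂ[[b]]`-linear bijection that commutes with `a`. -/
def Iso (E : Type u) [AddCommGroup E] [Module ℂ⟦X⟧ E] [AModule E]
    (E' : Type v) [AddCommGroup E'] [Module ℂ⟦X⟧ E'] [AModule E'] : Prop :=
  ∃ e : E ≃ₗ[ℂ⟦X⟧] E', ∀ x, e (AModule.a x) = AModule.a (e x)

/-- There is an injective morphism from `E` to `E'`, so that `E` is isomorphic to a submodule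
of `E'`. -/
def Embeds (E : Type u) [AddCommGroup E] [Module ℂ⟦X⟧ E] [AModule E]
    (E' : Type v) [AddCommGroup E'] [Module ℂ⟦X⟧ E'] [AModule E'] : Prop :=
  ∃ f : E →ₗ[ℂ⟦X⟧] E', Function.Injective f ∧ ∀ x, f (AModule.a x) = AModule.a (f x)

/-- A submodule: a `ℂ[[b]]`-submodule stable under `a`. -/
structure Sub (E : Type u) [AddCommGroup E] [Module ℂ⟦X⟧ E] [AModule E] extends
    Submodule ℂ⟦X⟧ E where
  a_mem : ∀ x ∈ carrier, AModule.a x ∈ carrier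

section Sub

variable {E : Type u} [AddCommGroup E] [Module ℂ⟦X⟧ E] [AModule E]

/-- A submodule with the restricted operator `a`. -/
instance (F : Sub E) : AModule F.toSubmodule where
  a :=
    { toFun := fun x => ⟨AModule.a (x : E), F.a_mem x x.2⟩
      map_zero' := by ext; simp
      map_add' := fun x y => by ext; simp }
  a_smul := fun S x => by
    ext
    simpa using AModule.a_smul S (x : E)

/-- A quotient with the induced operator `a`. -/
instance (F : Sub E) : AModule (E ⧸ F.toSubmodule) where
  a := QuotientAddGroup.map F.toSubmodule.toAddSubgroup F.toSubmodule.toAddSubgroup AModule.a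
    (fun x hx => F.a_mem x hx)
  a_smul := fun S x => by
    induction x using Submodule.Quotient.induction_on with
    | _ x =>
      exact congrArg (Submodule.Quotient.mk (p := F.toSubmodule)) (AModule.a_smul S x)

/-- `G ∩ F` as a submodule of `F`. -/
def Sub.within (G F : Sub E) : Sub F.toSubmodule where
  toSubmodule := G.toSubmodule.submoduleOf F.toSubmodule
  a_mem := fun x hx => G.a_mem x hx

/-- The submodule generated by `x`: the smallest `ℂ[[b]]`-submodule that contains `x` and is
stable under `a`. -/
def cyclic (x : E) : Sub E where
  toSubmodule := sInf {F | x ∈ F ∧ ∀ y ∈ F, AModule.a y ∈ F}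
  a_mem := fun y hy => by
    have hy' : y ∈ sInf {F : Submodule ℂ⟦X⟧ E | x ∈ F ∧ ∀ y ∈ F, AModule.a y ∈ F} := hy
    rw [Submodule.mem_sInf] at hy'
    refine (Submodule.mem_sInf).2 fun F hF => hF.2 y (hy' F hF)

open scoped Pointwise in
/-- A submodule `F` of `E` is normal when `F ∩ b E = b F`. -/
def Sub.IsNormal (F : Sub E) : Prop :=
  F.toSubmodule ⊓ (X : ℂ⟦X⟧) • (⊤ : Submodule ℂ⟦X⟧ E) = (X : ℂ⟦X⟧) • F.toSubmodule

end Sub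

/-- Finite direct sums. -/
instance {ι : Type v} (M : ι → Type u) [∀ i, AddCommGroup (M i)] [∀ i, Module ℂ⟦X⟧ (M i)]
    [∀ i, AModule (M i)] : AModule (∀ i, M i) where
  a :=
    { toFun := fun x i => AModule.a (x i)
      map_zero' := by ext; simp
      map_add' := fun x y => by ext; simp }
  a_smul := fun S x => by
    ext i
    exact AModule.a_smul S (x i)

/-! ### Regular (a,b)-modules and semi-simplicity -/

/-- An (a,b)-module: free of finite rank over `ℂ[[b]]`. -/
def IsABModule (E : Type u) [AddCommGroup E] [Module ℂ⟦X⟧ E] [AModule E] : Prop :=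
  Module.Free ℂ⟦X⟧ E ∧ Module.Finite ℂ⟦X⟧ E

/-- A simple pole (a,b)-module: `a E ⊆ b E`. -/
def IsSimplePole (E : Type u) [AddCommGroup E] [Module ℂ⟦X⟧ E] [AModule E] : Prop :=
  IsABModule E ∧ ∀ x : E, ∃ y : E, AModule.a x = (X : ℂ⟦X⟧) • y

/-- A regular (a,b)-module: one that embeds in a simple pole (a,b)-module. -/
def IsRegular (E : Type u) [AddCommGroup E] [Module ℂ⟦X⟧ E] [AModule E] : Prop :=
  IsABModule E ∧
    ∃ (M : Type u) (_ : AddCommGroup M) (_ : Module ℂ⟦X⟧ M) (_ : AModule M),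
      IsSimplePole M ∧ Embeds E M

/-- A semi-simple (a,b)-module: a submodule of a finite direct sum of regular (a,b)-modules
of rank one. -/
def IsSemisimple (E : Type u) [AddCommGroup E] [Module ℂ⟦X⟧ E] [AModule E] : Prop :=
  ∃ (n : ℕ) (M : Fin n → Type u) (_ : ∀ i, AddCommGroup (M i)) (_ : ∀ i, Module ℂ⟦X⟧ (M i))
    (_ : ∀ i, AModule (M i)),
    (∀ i, IsRegular (M i) ∧ Module.finrank ℂ⟦X⟧ (M i) = 1) ∧ Embeds E (∀ i, M i)

/-! ### Jordan-Hölder sequences -/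

/-- The rank one (a,b)-module `E_l`, free over `ℂ[[b]]` on a generator `e = 1` with
`a e = l b e`. -/
def RankOne (_l : ℂ) : Type := ℂ⟦X⟧

instance (l : ℂ) : AddCommGroup (RankOne l) := inferInstanceAs (AddCommGroup ℂ⟦X⟧)

instance (l : ℂ) : Module ℂ⟦X⟧ (RankOne l) := inferInstanceAs (Module ℂ⟦X⟧ ℂ⟦X⟧)

/-- The operator `a` of `E_l` on `S e`: `a S e = S a e + b ^ 2 S' e = (l b S + b ^ 2 S') e`. -/
def rankOneA (l : ℂ) : ℂ⟦X⟧ →+ ℂ⟦X⟧ where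
  toFun S := C l * X * S + X ^ 2 * derivative ℂ S
  map_zero' := by simp
  map_add' S T := by rw [map_add]; ring

instance (l : ℂ) : AModule (RankOne l) where
  a := rankOneA l
  a_smul := fun S (T : ℂ⟦X⟧) => by
    change (C l * X * (S * T) + X ^ 2 * derivative ℂ (S * T) : ℂ⟦X⟧) =
      S * (C l * X * T + X ^ 2 * derivative ℂ T) + (X ^ 2 * derivative ℂ S) * T
    rw [Derivation.leibniz, smul_eq_mul, smul_eq_mul]; ring

/-- A Jordan-Hölder sequence `0 = F_0 ⊆ F_1 ⊆ ⋯ ⊆ F_k = E`: normal submodules with quotients of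
rank one. -/
structure IsJordanHolder {E : Type u} [AddCommGroup E] [Module ℂ⟦X⟧ E] [AModule E] {k : ℕ}
    (F : Fin (k + 1) → Sub E) : Prop where
  zero : (F 0).toSubmodule = ⊥
  last : (F (Fin.last k)).toSubmodule = ⊤
  le_succ : ∀ j : Fin k, (F j.castSucc).toSubmodule ≤ (F j.succ).toSubmodule
  normal : ∀ j, (F j).IsNormal
  rank_one : ∀ j : Fin k, Module.finrank ℂ⟦X⟧
    ((F j.succ).toSubmodule ⧸ ((F j.castSucc).within (F j.succ)).toSubmodule) = 1

/-- The Jordan-Hölder sequence `F` has quotients corresponding to the numbers `l_1, …, l_k`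
(indexed here from `0`): `F_j / F_{j-1} ≃ E_{l_j}`. -/
def HasNumbers {E : Type u} [AddCommGroup E] [Module ℂ⟦X⟧ E] [AModule E] {k : ℕ}
    (F : Fin (k + 1) → Sub E) (l : Fin k → ℂ) : Prop :=
  ∀ j : Fin k,
    Iso ((F j.succ).toSubmodule ⧸ ((F j.castSucc).within (F j.succ)).toSubmodule) (RankOne (l j))

/-- `m_1, …, m_k` is a twisted permutation of `l_1, …, l_k`: the sequence `m_j + j` is a
permutation of the sequence `l_j + j`. -/
def IsTwistedPermutation {k : ℕ} (l m : Fin k → ℂ) : Prop :=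
  ∃ s : Equiv.Perm (Fin k), ∀ j : Fin k,
    m j + ((j : ℕ) + 1 : ℂ) = l (s j) + ((s j : ℕ) + 1 : ℂ)

/-! ### Formal asymptotic expansions -/

/-- For `q ∈ ℚ ∩ ]0,1]`, the space of the formal expansions
`∑_{n ≥ 0} ∑_{j ≤ N} f n j * s ^ (q - 1 + n) * (Log s) ^ j`. -/
def Xi (_q : Set.Ioc (0 : ℚ) 1) (N : ℕ) : Type := ℕ → Fin (N + 1) → ℂ

namespace Xi

variable {q : Set.Ioc (0 : ℚ) 1} {N : ℕ}

instance : AddCommGroup (Xi q N) := inferInstanceAs (AddCommGroup (ℕ → Fin (N + 1) → ℂ))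

instance : Module ℂ (Xi q N) := inferInstanceAs (Module ℂ (ℕ → Fin (N + 1) → ℂ))

@[ext]
theorem ext {f g : Xi q N} (h : ∀ n, f n = g n) : f = g := funext h

theorem add_apply (f g : Xi q N) (n : ℕ) : (f + g) n = f n + g n := rfl

theorem zero_apply (n : ℕ) : (0 : Xi q N) n = 0 := rfl

theorem sub_apply (f g : Xi q N) (n : ℕ) : (f - g) n = f n - g n := rfl

theorem csmul_apply (c : ℂ) (f : Xi q N) (n : ℕ) : (c • f) n = c • f n := rfl

theorem sum_apply {ι : Type*} (t : Finset ι) (f : ι → Xi q N) (n : ℕ) :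
    (∑ i ∈ t, f i) n = ∑ i ∈ t, f i n :=
  map_sum (Pi.evalAddMonoidHom (fun _ : ℕ => Fin (N + 1) → ℂ) n) f t

/-- Multiplication by `s`. -/
def a : Xi q N →ₗ[ℂ] Xi q N where
  toFun f := fun n => match n with
    | 0 => 0
    | n + 1 => f n
  map_add' f g := by
    ext n : 1
    cases n with
    | zero => exact (add_zero (0 : Fin (N + 1) → ℂ)).symm
    | succ n => rfl
  map_smul' c f := by
    ext n : 1
    cases n with
    | zero => exact (smul_zero c).symm
    | succ n => rfl

theorem a_zero (f : Xi q N) : a f 0 = 0 := rfl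

theorem a_succ (f : Xi q N) (n : ℕ) : a f (n + 1) = f n := rfl

/-- The derivation with respect to `Log s`, on polynomials `∑_{j ≤ N} v_j (Log s) ^ j`. -/
def logD (N : ℕ) : Module.End ℂ (Fin (N + 1) → ℂ) where
  toFun v := fun j => if h : (j : ℕ) + 1 < N + 1 then ((j : ℕ) + 1 : ℂ) * v ⟨j + 1, h⟩ else 0
  map_add' v w := by
    ext j
    simp only [Pi.add_apply]
    split_ifs
    · rw [mul_add]
    · rw [add_zero]
  map_smul' c v := by
    ext j
    simp only [Pi.smul_apply, smul_eq_mul, RingHom.id_apply]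
    split_ifs
    · rw [mul_left_comm]
    · rw [mul_zero]

theorem logD_apply (v : Fin (N + 1) → ℂ) (j : Fin (N + 1)) : logD N v j =
    if h : (j : ℕ) + 1 < N + 1 then ((j : ℕ) + 1 : ℂ) * v ⟨j + 1, h⟩ else 0 := rfl

theorem logD_pow_apply (m : ℕ) (v : Fin (N + 1) → ℂ) (j : Fin (N + 1))
    (h : N < m + j) : (logD N ^ m) v j = 0 := by
  induction m generalizing j with
  | zero => omega
  | succ m ih =>
    rw [pow_succ', Module.End.mul_apply, logD_apply]
    split_ifs with hj
    · rw [ih ⟨j + 1, hj⟩ (by simp only; omega), mul_zero]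
    · rfl

theorem logD_pow : logD N ^ (N + 1) = 0 := by
  ext v j
  simpa using logD_pow_apply (N + 1) (Pi.single v 1) j (by omega)

/-- For `c ≠ 0`, the inverse `∑_m (-1) ^ m c ^ (-m-1) D ^ m` of `c + D`, where `D = logD N`:
since `d/ds (s ^ c * w(Log s)) = s ^ (c - 1) * ((c + D) w)(Log s)`, it gives the primitive of
`s ^ (c - 1) * v(Log s)`. -/
def prim (N : ℕ) (c : ℂ) : Module.End ℂ (Fin (N + 1) → ℂ) :=
  ∑ m ∈ Finset.range (N + 1), ((-1) ^ m * c⁻¹ ^ (m + 1)) • logD N ^ m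

theorem prim_spec {c : ℂ} (hc : c ≠ 0) : (c • 1 + logD N) * prim N c = 1 := by
  have key : ∀ M : ℕ, (c • 1 + logD N) *
      ∑ m ∈ Finset.range M, ((-1 : ℂ) ^ m * c⁻¹ ^ (m + 1)) • logD N ^ m =
      1 - ((-1 : ℂ) ^ M * c⁻¹ ^ M) • logD N ^ M := by
    intro M
    induction M with
    | zero => simp
    | succ M ih =>
      rw [Finset.sum_range_succ, mul_add, ih, add_mul, smul_mul_assoc, one_mul, smul_smul,
        mul_smul_comm, ← pow_succ']
      have : c * ((-1) ^ M * c⁻¹ ^ (M + 1)) = (-1) ^ M * c⁻¹ ^ M := by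
        rw [pow_succ]; field_simp
      rw [this, pow_succ (-1 : ℂ) M]
      module
  rw [prim, key, logD_pow]
  simp

theorem prim_spec' {c : ℂ} (hc : c ≠ 0) : prim N c * (c • 1 + logD N) = 1 :=
  mul_eq_one_comm.1 (prim_spec hc)

theorem prim_eq (N : ℕ) {c : ℂ} (h0 : c ≠ 0) (h1 : c + 1 ≠ 0) :
    prim N c = prim N (c + 1) + prim N (c + 1) * prim N c := by
  have h : ((c + 1) • 1 + logD N) * prim N c = 1 + prim N c := by
    have : (c + 1) • 1 + logD N = (c • 1 + logD N) + 1 := by module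
    rw [this, add_mul, prim_spec h0, one_mul]
  calc prim N c = prim N (c + 1) * (((c + 1) • 1 + logD N) * prim N c) := by
        rw [← mul_assoc, prim_spec' h1, one_mul]
    _ = _ := by rw [h, mul_add, mul_one]

/-- The primitive in `s` without constant. -/
def b : Module.End ℂ (Xi q N) where
  toFun f := fun n => match n with
    | 0 => 0
    | n + 1 => prim N (((q : ℚ) : ℂ) + n) (f n)
  map_add' f g := by
    ext n : 1
    cases n with
    | zero => exact (add_zero (0 : Fin (N + 1) → ℂ)).symm
    | succ n => exact map_add (prim N (((q : ℚ) : ℂ) + n)) (f n) (g n)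
  map_smul' c f := by
    ext n : 1
    cases n with
    | zero => exact (smul_zero c).symm
    | succ n => exact map_smul (prim N (((q : ℚ) : ℂ) + n)) c (f n)

theorem b_zero (f : Xi q N) : b f 0 = 0 := rfl

theorem b_succ (f : Xi q N) (n : ℕ) : b f (n + 1) = prim N (((q : ℚ) : ℂ) + n) (f n) := rfl

theorem exponent_ne_zero (q : Set.Ioc (0 : ℚ) 1) (n : ℕ) : ((q : ℚ) : ℂ) + n ≠ 0 := by
  have h : (0 : ℚ) < (q : ℚ) + n := add_pos_of_pos_of_nonneg q.2.1 (Nat.cast_nonneg n)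
  exact_mod_cast h.ne'

theorem a_b (f : Xi q N) : a (b f) = b (a f) + b (b f) := by
  ext n : 1
  rw [add_apply]
  rcases n with _ | _ | n
  · simp [a_zero, b_zero]
  · rw [a_succ, b_succ, b_succ, a_zero, b_zero]; simp
  · rw [a_succ, b_succ, b_succ, a_succ, b_succ, b_succ]
    set c : ℂ := ((q : ℚ) : ℂ) + n with hc
    have hc' : ((q : ℚ) : ℂ) + ((n + 1 : ℕ) : ℂ) = c + 1 := by rw [hc]; push_cast; ring
    rw [hc']
    have h0 : c ≠ 0 := exponent_ne_zero q n
    have h1 : c + 1 ≠ 0 := by rw [← hc']; exact exponent_ne_zero q (n + 1)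
    have e := prim_eq N h0 h1
    conv_lhs => rw [e]
    rfl

theorem a_b_pow (p : ℕ) (f : Xi q N) :
    a ((b ^ p) f) = (b ^ p) (a f) + (p : ℂ) • (b ^ (p + 1)) f := by
  induction p generalizing f with
  | zero => simp
  | succ p ih =>
    have h1 : (b ^ (p + 1)) f = (b ^ p) (b f) := by rw [pow_succ, Module.End.mul_apply]
    have h2 : (b ^ (p + 1)) (a f) = (b ^ p) (b (a f)) := by rw [pow_succ, Module.End.mul_apply]
    have h3 : (b ^ (p + 1 + 1)) f = (b ^ p) (b (b f)) := by
      rw [pow_succ, pow_succ, Module.End.mul_apply, Module.End.mul_apply]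
    have h4 : (b ^ (p + 1)) (b f) = (b ^ p) (b (b f)) := by rw [pow_succ, Module.End.mul_apply]
    rw [h1, ih, a_b, map_add, h2, h3, h4]
    push_cast
    module

theorem b_pow_congr (p : ℕ) {f g : Xi q N} {n : ℕ} (h : ∀ m ≤ n, f m = g m) :
    ∀ m ≤ n, (b ^ p) f m = (b ^ p) g m := by
  induction p with
  | zero => simpa using h
  | succ p ih =>
    intro m hm
    rw [pow_succ', Module.End.mul_apply, Module.End.mul_apply]
    cases m with
    | zero => rfl
    | succ m => rw [b_succ, b_succ, ih m (by omega)]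

theorem b_pow_apply_of_lt (p : ℕ) (f : Xi q N) {n : ℕ} (h : n < p) : (b ^ p) f n = 0 := by
  induction p generalizing n with
  | zero => omega
  | succ p ih =>
    rw [pow_succ', Module.End.mul_apply]
    cases n with
    | zero => rfl
    | succ n => rw [b_succ, ih (by omega), map_zero]

/-- The action `S(b) f = ∑_p S_p b ^ p f` of `ℂ[[b]]`; only the terms with `p ≤ n` contribute to
the coefficients of `s ^ (q - 1 + n) * (Log s) ^ j`. -/
instance : SMul ℂ⟦X⟧ (Xi q N) where
  smul S f := fun n => ∑ p ∈ Finset.range (n + 1), coeff p S • (b ^ p) f n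

theorem smul_apply (S : ℂ⟦X⟧) (f : Xi q N) (n : ℕ) :
    (S • f) n = ∑ p ∈ Finset.range (n + 1), coeff p S • (b ^ p) f n := rfl

theorem smul_apply_of_le (S : ℂ⟦X⟧) (f : Xi q N) {n M : ℕ} (h : n ≤ M) :
    (S • f) n = ∑ p ∈ Finset.range (M + 1), coeff p S • (b ^ p) f n := by
  rw [smul_apply]
  refine Finset.sum_subset (fun p hp => ?_) fun p _ hp => ?_
  · rw [Finset.mem_range] at hp ⊢; omega
  · rw [Finset.mem_range] at hp
    rw [b_pow_apply_of_lt p f (by omega), smul_zero]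

theorem mul_smul' (S T : ℂ⟦X⟧) (f : Xi q N) : (S * T) • f = S • T • f := by
  ext n : 1
  have h1 : ∀ p, (b ^ p) (T • f) n =
      ∑ r ∈ Finset.range (n + 1), coeff r T • (b ^ (p + r)) f n := by
    intro p
    have := b_pow_congr p (f := T • f)
      (g := ∑ r ∈ Finset.range (n + 1), coeff r T • (b ^ r) f) (n := n)
      (fun m hm => by
        rw [smul_apply_of_le T f hm, sum_apply]; rfl) n le_rfl
    rw [this, map_sum, sum_apply]
    refine Finset.sum_congr rfl fun r _ => ?_
    rw [map_smul, csmul_apply, pow_add, Module.End.mul_apply]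
  rw [smul_apply S]
  simp only [h1]
  rw [smul_apply]
  have h2 : ∀ m ∈ Finset.range (n + 1), coeff m (S * T) • (b ^ m) f n =
      ∑ p ∈ Finset.range (m + 1),
        (fun i j => (coeff i S * coeff j T) • (b ^ (i + j)) f n) p (m - p) := by
    intro m _
    rw [coeff_mul, Finset.Nat.sum_antidiagonal_eq_sum_range_succ
      (fun i j => coeff i S * coeff j T), Finset.sum_smul]
    refine Finset.sum_congr rfl fun p hp => ?_
    rw [Finset.mem_range] at hp
    have : p + (m - p) = m := by omega
    simp only [this]
  rw [Finset.sum_congr rfl h2]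
  refine (Finset.sum_range_diag_flip (n + 1)
    (fun i j => (coeff i S * coeff j T) • (b ^ (i + j)) f n)).trans ?_
  refine Finset.sum_congr rfl fun p _ => ?_
  rw [Finset.smul_sum]
  simp only [smul_smul]
  refine Finset.sum_subset (fun r hr => ?_) fun r _ hr => ?_
  · rw [Finset.mem_range] at hr ⊢; omega
  · rw [Finset.mem_range] at hr
    rw [b_pow_apply_of_lt (p + r) f (by omega), smul_zero]

instance : Module ℂ⟦X⟧ (Xi q N) where
  one_smul f := by
    ext n : 1
    rw [smul_apply, Finset.sum_eq_single 0]
    · simp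
    · intro p _ hp
      rw [coeff_one, if_neg hp, zero_smul]
    · simp
  mul_smul := mul_smul'
  smul_zero S := by
    ext n : 1
    rw [smul_apply, zero_apply]
    exact Finset.sum_eq_zero fun p _ => by rw [map_zero, zero_apply, smul_zero]
  smul_add S f g := by
    ext n : 1
    simp only [smul_apply, add_apply, map_add, smul_add, Finset.sum_add_distrib]
  add_smul S T f := by
    ext n : 1
    simp only [smul_apply, add_apply, map_add, add_smul, Finset.sum_add_distrib]
  zero_smul f := by
    ext n : 1
    simp only [smul_apply, zero_apply, map_zero, zero_smul, Finset.sum_const_zero]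

instance : SMulCommClass ℂ ℂ⟦X⟧ (Xi q N) where
  smul_comm c S f := by
    ext n : 1
    simp only [smul_apply, csmul_apply, map_smul, Finset.smul_sum]
    exact Finset.sum_congr rfl fun p _ => smul_comm _ _ _

theorem a_smul (S : ℂ⟦X⟧) (f : Xi q N) :
    a (S • f) = S • a f + (X ^ 2 * derivative ℂ S) • f := by
  ext n : 1
  cases n with
  | zero => simp [a_zero, add_apply, smul_apply, coeff_X_pow_mul']
  | succ n =>
    have hX : ∀ p, coeff (p + 1) (X ^ 2 * derivative ℂ S) = coeff p S * p := by
      intro p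
      rw [coeff_X_pow_mul']
      rcases p with _ | p
      · simp
      · rw [if_pos (by omega), show p + 1 + 1 - 2 = p by omega, coeff_derivative]
        push_cast; ring
    have h0 : coeff 0 (X ^ 2 * derivative ℂ S) = 0 := by simp [coeff_X_pow_mul']
    have htop : (b ^ (n + 1)) (a f) (n + 1) = 0 := by
      have h := congrArg (fun g : Xi q N => g (n + 1)) (a_b_pow (n + 1) f)
      simp only [add_apply, csmul_apply, a_succ] at h
      rw [b_pow_apply_of_lt (n + 1) f (by omega),
        b_pow_apply_of_lt (n + 1 + 1) f (by omega), smul_zero, add_zero] at h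
      exact h.symm
    rw [a_succ, add_apply, smul_apply, smul_apply, smul_apply, Finset.sum_range_succ _ (n + 1),
      htop, smul_zero, add_zero, Finset.sum_range_succ' _ (n + 1), h0, zero_smul, add_zero,
      ← Finset.sum_add_distrib]
    refine Finset.sum_congr rfl fun p _ => ?_
    have h := congrArg (fun g : Xi q N => g (n + 1)) (a_b_pow p f)
    simp only [add_apply, csmul_apply, a_succ] at h
    rw [h, hX, smul_add, smul_smul]

end Xi

/-- `Ξ_Λ^{(N)} ⊗ V`, with `Ξ_Λ^{(N)}` the direct sum of the `Ξ_q^{(N)}` for `q` in the finite set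
`Λ`. -/
abbrev XiTensor (L : Finset (Set.Ioc (0 : ℚ) 1)) (N : ℕ) (V : Type v) [AddCommGroup V]
    [Module ℂ V] : Type v :=
  (∀ q : L, Xi (q : Set.Ioc (0 : ℚ) 1) N) ⊗[ℂ] V

/-- `a (φ ⊗ v) = (a φ) ⊗ v`; the action of `ℂ[[b]]` is that of Mathlib, with
`S (φ ⊗ v) = (S φ) ⊗ v`. -/
instance (L : Finset (Set.Ioc (0 : ℚ) 1)) (N : ℕ) (V : Type v) [AddCommGroup V]
    [Module ℂ V] : AModule (XiTensor L N V) where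
  a := (LinearMap.rTensor V
    (LinearMap.pi fun q : L => Xi.a ∘ₗ LinearMap.proj q)).toAddMonoidHom
  a_smul := fun S x => by
    induction x using TensorProduct.induction_on with
    | zero => simp
    | tmul f v =>
      simp only [LinearMap.toAddMonoidHom_coe, TensorProduct.smul_tmul', LinearMap.rTensor_tmul]
      rw [← TensorProduct.add_tmul]
      congr 1
      ext q : 1
      exact Xi.a_smul S (f q)
    | add x y hx hy =>
      rw [smul_add, map_add, hx, hy, map_add, smul_add, smul_add]
      abel

/-- A fresco: a module isomorphic to the submodule generated by some element `φ` of
`Ξ_Λ^{(N)} ⊗ V`, for some finite `Λ ⊆ ℚ ∩ ]0,1]`, some `N` and some finite dimensional complex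
vector space `V`. -/
def IsFresco (E : Type u) [AddCommGroup E] [Module ℂ⟦X⟧ E] [AModule E] : Prop :=
  ∃ (L : Finset (Set.Ioc (0 : ℚ) 1)) (N : ℕ) (V : Type) (_ : AddCommGroup V) (_ : Module ℂ V)
    (_ : FiniteDimensional ℂ V) (φ : XiTensor L N V), Iso E (cyclic φ).toSubmodule

end Fresco

end

/-! Put `κ j = λ_j + j`. Adjacent transpositions generate the symmetric group, so it is enough to
exchange two neighbouring values of `κ`, that is, to replace `(c₁, c₂)` by `(c₂ + 1, c₁ - 1)` in a
rank two subquotient with `a e₁ = c₁ b e₁` and `a e₂ = c₂ b e₂ + s e₁`. If `c₂ + 1 = c₁` nothing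
changes. Otherwise one looks for `x = U e₁ + b e₂` with `a x = (c₂ + 1) b x`, which amounts to `(c₁
- c₂ - 1) U + b U' + s = 0`; when `U` is a unit, `x` spans the new first step
(`IsStep.swap_of_solution`). Both hypotheses on `E` enter here. Being cyclic makes `s` a unit
(`IsStep.isUnit_of_generated`, `IsChain.generated`), hence `U` too. Semi-simplicity supplies enough
morphisms to rank one modules (`Separated`) to kill the one coefficient of `s` that could obstruct
the equation (`coeff_eq_zero_of_resonance`). -/

noncomputable section

namespace Fresco

universe u

/-- Lets `module` normalize scalars in `ℂ⟦X⟧`. -/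
instance isScalarTower_nat (E : Type u) [AddCommGroup E] [Module ℂ⟦X⟧ E] :
    @IsScalarTower ℕ ℂ⟦X⟧ E (MvPowerSeries.instAlgebra (σ := Unit)).toSMul _ _ :=
  letI : SMul ℕ ℂ⟦X⟧ := (MvPowerSeries.instAlgebra (σ := Unit)).toSMul
  { smul_assoc := fun n S x => by
      have : n • S = (n : ℂ⟦X⟧) * S :=
        (Algebra.smul_def n S).trans (congrArg (· * S) (eq_natCast (algebraMap ℕ ℂ⟦X⟧) n))
      rw [this, mul_smul, Nat.cast_smul_eq_nsmul] }

/-- Lets `module` normalize scalars in `ℂ⟦X⟧`. -/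
instance isScalarTower_int (E : Type u) [AddCommGroup E] [Module ℂ⟦X⟧ E] :
    @IsScalarTower ℤ ℂ⟦X⟧ E (MvPowerSeries.instAlgebra (σ := Unit)).toSMul _ _ :=
  letI : SMul ℤ ℂ⟦X⟧ := (MvPowerSeries.instAlgebra (σ := Unit)).toSMul
  { smul_assoc := fun n S x => by
      have : n • S = (n : ℂ⟦X⟧) * S :=
        (Algebra.smul_def n S).trans (congrArg (· * S) (eq_intCast (algebraMap ℤ ℂ⟦X⟧) n))
      rw [this, mul_smul, Int.cast_smul_eq_zsmul] }

/-! ### Exchanging two consecutive rank one quotients. -/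

section Steps

variable {E : Type u} [AddCommGroup E] [Module ℂ⟦X⟧ E] [AModule E]

/-- Stability of a `ℂ[[b]]`-submodule under `a`. -/
def AStable (F : Submodule ℂ⟦X⟧ E) : Prop := ∀ x ∈ F, AModule.a x ∈ F

/-- `G` is `F ⊕ ℂ[[b]] e`, and `a e = c b e` modulo `F`. -/
structure IsStep (F G : Submodule ℂ⟦X⟧ E) (e : E) (c : ℂ) : Prop where
  le : F ≤ G
  mem : e ∈ G
  gen : ∀ x ∈ G, ∃ S : ℂ⟦X⟧, x - S • e ∈ F
  free : ∀ S : ℂ⟦X⟧, S • e ∈ F → S = 0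
  a_mem : AModule.a e - (C c * X : ℂ⟦X⟧) • e ∈ F

namespace IsStep

variable {F G : Submodule ℂ⟦X⟧ E} {e : E} {c : ℂ}

theorem aStable (h : IsStep F G e c) (hF : AStable F) : AStable G := by
  intro x hx
  obtain ⟨S, hS⟩ := h.gen x hx
  have h1 := h.le (hF _ hS)
  rw [map_sub, AModule.a_smul] at h1
  have h2 := G.add_mem h1 (G.add_mem (G.smul_mem S (h.le h.a_mem))
    (G.smul_mem (S * (C c * X) + X ^ 2 * derivative ℂ S) h.mem))
  convert h2 using 1
  module

/-- The quotient `G / F` is free on `e`, hence torsion-free. -/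
theorem saturated (h : IsStep F G e c) {W : ℂ⟦X⟧} (hW : W ≠ 0) {x : E} (hx : x ∈ G)
    (hWx : W • x ∈ F) : x ∈ F := by
  obtain ⟨S, hS⟩ := h.gen x hx
  have h1 : (W * S) • e ∈ F := by
    have := F.sub_mem hWx (F.smul_mem W hS)
    convert this using 1
    module
  have h2 : S = 0 := (mul_eq_zero.1 (h.free _ h1)).resolve_left hW
  simpa [h2] using hS

theorem not_mem (h : IsStep F G e c) : e ∉ F := fun he =>
  one_ne_zero (h.free 1 (by simpa using he))

end IsStep

/-- If `a e₂ = c₂ b e₂ + s e₁` and `U` solves `(c₁ - c₂ - 1) U + b U' + s = 0`, then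
`U e₁ + b e₂` generates a submodule isomorphic to `E_{c₂ + 1}`, with quotient `E_{c₁ - 1}`. -/
theorem IsStep.swap_of_solution {F₀ F₁ F₂ : Submodule ℂ⟦X⟧ E} {e₁ e₂ : E} {c₁ c₂ : ℂ}
    (h1 : IsStep F₀ F₁ e₁ c₁) (h2 : IsStep F₁ F₂ e₂ c₂) (hF : AStable F₀) {s U V : ℂ⟦X⟧}
    (hs : AModule.a e₂ - (C c₂ * X : ℂ⟦X⟧) • e₂ - s • e₁ ∈ F₀)
    (hU : (C c₁ - C c₂ - 1) * U + X * derivative ℂ U + s = 0) (hUV : U * V = 1) :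
    ∃ (G : Submodule ℂ⟦X⟧ E) (x y : E), IsStep F₀ G x (c₂ + 1) ∧ IsStep G F₂ y (c₁ - 1) := by
  set x : E := U • e₁ + (X : ℂ⟦X⟧) • e₂ with hx
  -- Normalised so that `b y = e₁ - V x`: modulo `G`, `e₁` becomes `b y`, which lowers `c₁` by one.
  set y : E := (-V) • e₂ with hy
  have he₁ : e₁ ∈ F₂ := h2.le h1.mem
  set G : Submodule ℂ⟦X⟧ E := F₀ ⊔ Submodule.span ℂ⟦X⟧ {x} with hG
  have memG : ∀ z, z ∈ G ↔ ∃ S : ℂ⟦X⟧, z - S • x ∈ F₀ := by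
    intro z
    rw [hG, Submodule.mem_sup]
    constructor
    · rintro ⟨f, hf, w, hw, rfl⟩
      obtain ⟨S, rfl⟩ := Submodule.mem_span_singleton.1 hw
      exact ⟨S, by simpa using hf⟩
    · rintro ⟨S, hS⟩
      exact ⟨_, hS, S • x, Submodule.mem_span_singleton.2 ⟨S, rfl⟩, by simp⟩
  have hxG : x ∈ G := (memG x).2 ⟨1, by simp⟩
  have hFG : F₀ ≤ G := le_sup_left
  have hxF : x ∈ F₂ := F₂.add_mem (F₂.smul_mem _ he₁) (F₂.smul_mem _ h2.mem)
  have hyF : y ∈ F₂ := F₂.smul_mem _ h2.mem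
  have hU0 : U ≠ 0 := left_ne_zero_of_mul_eq_one hUV
  have hby : (X : ℂ⟦X⟧) • y = e₁ - V • x := by
    have : e₁ = (U * V) • e₁ := by rw [hUV, one_smul]
    rw [hx, hy]
    nth_rw 1 [this]
    module
  have st1 : IsStep F₀ G x (c₂ + 1) := by
    refine ⟨hFG, hxG, fun z hz => (memG z).1 hz, fun S hS => ?_, ?_⟩
    · have h3 : (S * X) • e₂ ∈ F₁ := by
        have := F₁.sub_mem (h1.le hS) (F₁.smul_mem (S * U) h1.mem)
        convert this using 1
        rw [hx]; module
      exact (mul_eq_zero.1 (h2.free _ h3)).resolve_right X_ne_zero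
    · have h3 := F₀.add_mem (F₀.smul_mem U h1.a_mem) (F₀.smul_mem X hs)
      convert h3 using 1
      -- The only part of `a x - (c₂ + 1) b x` not visibly in `F₀` is `b` times the left side of
      -- `hU`, along `e₁`.
      have h4 : (X * ((C c₁ - C c₂ - 1) * U + X * derivative ℂ U + s)) • e₁ = 0 := by
        rw [hU, mul_zero, zero_smul]
      rw [← sub_eq_zero, ← h4, hx, map_add, AModule.a_smul, AModule.a_smul, derivative_X, map_add,
        map_one]
      module
  have hGst : AStable G := st1.aStable hF
  have hF₂ : AStable F₂ := h2.aStable (h1.aStable hF)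
  have hGF : G ≤ F₂ := by
    intro z hz
    obtain ⟨S, hS⟩ := (memG z).1 hz
    have := F₂.add_mem (h2.le (h1.le hS)) (F₂.smul_mem S hxF)
    simpa using this
  have gen : ∀ z ∈ F₂, ∃ S : ℂ⟦X⟧, z - S • y ∈ G := by
    intro z hz
    obtain ⟨p, hp⟩ := h2.gen z hz
    obtain ⟨q, hq⟩ := h1.gen _ hp
    refine ⟨-(p * U) + q * X, ?_⟩
    have h3 := G.add_mem (hFG hq) (G.smul_mem (q * V) hxG)
    convert h3 using 1
    have h4 : p • e₂ = (p * U * V) • e₂ := by rw [mul_assoc, hUV, mul_one]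
    have h5 : (q * X) • y = q • e₁ - (q * V) • x := by rw [mul_smul, hby]; module
    rw [add_smul, h5, h4, hy]
    module
  have free : ∀ S : ℂ⟦X⟧, S • y ∈ G → S = 0 := by
    intro S hS
    obtain ⟨p, hp⟩ := (memG _).1 hS
    have h3 : (S * V + p * X) • e₂ ∈ F₁ := by
      have := F₁.sub_mem (F₁.neg_mem (h1.le hp)) (F₁.smul_mem (p * U) h1.mem)
      convert this using 1
      rw [hx, hy]; module
    have h4 := h2.free _ h3
    have h5 : (p * U) • e₁ ∈ F₀ := by
      have h6 : (S * V + p * X) • e₂ = 0 := by rw [h4, zero_smul]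
      have := F₀.neg_mem hp
      convert this using 1
      rw [← sub_eq_zero, ← neg_eq_zero, ← h6, hx, hy]
      module
    have h6 : p = 0 := (mul_eq_zero.1 (h1.free _ h5)).resolve_right hU0
    have h7 : S * V = 0 := by simpa [h6] using h4
    calc S = S * V * U := by rw [mul_assoc, mul_comm V, hUV, mul_one]
      _ = 0 := by rw [h7, zero_mul]
  refine ⟨G, x, y, st1, hGF, hyF, gen, free, ?_⟩
  obtain ⟨S, hS⟩ := gen (AModule.a y - (C (c₁ - 1) * X : ℂ⟦X⟧) • y)
    (F₂.sub_mem (hF₂ _ hyF) (F₂.smul_mem _ hyF))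
  -- Since `b y ≡ e₁` and `a b = b a + b ^ 2`, the relation `a e₁ ≡ c₁ b e₁` gives the wanted one
  -- multiplied by `b`; freeness of `F₂ / G` then permits cancelling `b`.
  have h3 : (X : ℂ⟦X⟧) • (AModule.a y - (C (c₁ - 1) * X : ℂ⟦X⟧) • y) ∈ G := by
    have h4 : AModule.a ((X : ℂ⟦X⟧) • y) - (C c₁ * X : ℂ⟦X⟧) • ((X : ℂ⟦X⟧) • y) ∈ G := by
      have h5 := G.sub_mem (hFG h1.a_mem) (G.sub_mem (hGst _ (G.smul_mem V hxG))
        (G.smul_mem (C c₁ * X * V) hxG))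
      rw [hby, map_sub]
      convert h5 using 1
      module
    rw [AModule.a_smul, derivative_X] at h4
    convert h4 using 1
    rw [map_sub, map_one]
    module
  have h4 : (X * S) • y ∈ G := by
    have := G.sub_mem h3 (G.smul_mem X hS)
    convert this using 1
    module
  have h5 : S = 0 := (mul_eq_zero.1 (free _ h4)).resolve_left X_ne_zero
  simpa [h5] using hS

/-- A morphism, up to the choice of the operator `a` on `ℂ[[b]]`, from `E` to a rank one module:
`f (a x) = T f x + b ^ 2 (f x)'`. -/
def IsMor (T : ℂ⟦X⟧) (f : E →ₗ[ℂ⟦X⟧] ℂ⟦X⟧) : Prop :=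
  ∀ x, f (AModule.a x) = T * f x + X ^ 2 * derivative ℂ (f x)

/-- The morphisms from `E / F` to modules of rank one separate points. -/
def Separated (F : Submodule ℂ⟦X⟧ E) : Prop :=
  ∀ x ∉ F, ∃ (T : ℂ⟦X⟧) (f : E →ₗ[ℂ⟦X⟧] ℂ⟦X⟧), IsMor T f ∧ (∀ y ∈ F, f y = 0) ∧ f x ≠ 0

theorem IsMor.map_a_of_mem {T : ℂ⟦X⟧} {f : E →ₗ[ℂ⟦X⟧] ℂ⟦X⟧} (hf : IsMor T f)
    {F : Submodule ℂ⟦X⟧ E} (hF : ∀ y ∈ F, f y = 0) {e : E} {c : ℂ}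
    (he : AModule.a e - (C c * X : ℂ⟦X⟧) • e ∈ F) :
    T * f e + X ^ 2 * derivative ℂ (f e) = C c * X * f e := by
  have := hF _ he
  rw [map_sub, hf, map_smul, smul_eq_mul, sub_eq_zero] at this
  exact this

/-- Choose `f` nonzero at `e`, then `f'` nonzero at `f(e) x - f(x) e`, both vanishing on `F`. The
2×2 determinant `f(e) f' - f'(e) f` vanishes on `e`, hence on `G`, but not at `x`. It is again a
morphism to a rank one module because `f(e)` and `f'(e)` are both eigenvectors for `c b`. -/
theorem Separated.of_step {F G : Submodule ℂ⟦X⟧ E} {e : E} {c : ℂ} (hF : Separated F)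
    (h : IsStep F G e c) (hsat : ∀ (W : ℂ⟦X⟧) (x : E), W ≠ 0 → W • x ∈ G → x ∈ G) :
    Separated G := by
  intro x hx
  obtain ⟨T, f, hf, hfF, hfe⟩ := hF e h.not_mem
  have hy : f e • x - f x • e ∉ F := by
    intro hy
    refine hx (hsat (f e) x hfe ?_)
    have := G.add_mem (h.le hy) (G.smul_mem (f x) h.mem)
    simpa using this
  obtain ⟨T', f', hf', hfF', hfy⟩ := hF _ hy
  have k := hf.map_a_of_mem hfF h.a_mem
  have k' := hf'.map_a_of_mem hfF' h.a_mem
  refine ⟨T + T' - C c * X, f e • f' - f' e • f, fun z => ?_, fun z hz => ?_, ?_⟩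
  · simp only [LinearMap.sub_apply, LinearMap.smul_apply, smul_eq_mul, hf z, hf' z, map_sub,
      Derivation.leibniz]
    linear_combination f z * k' - f' z * k
  · obtain ⟨S, hS⟩ := h.gen z hz
    have z1 := hfF _ hS
    have z2 := hfF' _ hS
    rw [map_sub, map_smul, smul_eq_mul] at z1 z2
    simp only [LinearMap.sub_apply, LinearMap.smul_apply, smul_eq_mul]
    linear_combination f e * z2 - f' e * z1
  · intro h0
    apply hfy
    simp only [LinearMap.sub_apply, LinearMap.smul_apply, smul_eq_mul, map_sub, map_smul] at h0 ⊢
    linear_combination h0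

/-- In a rank one module, the equations `a W = c b W` with `W ≠ 0` and
`a Z = (c + p) b Z + s W` leave no room for a resonant term in `s`. -/
theorem coeff_eq_zero_of_resonance {T W Z s : ℂ⟦X⟧} {c : ℂ} {p : ℕ} (hW0 : W ≠ 0)
    (hW : T * W + X ^ 2 * derivative ℂ W = C c * X * W)
    (hZ : T * Z + X ^ 2 * derivative ℂ Z = C (c + p) * X * Z + s * W) :
    coeff (p + 1) s = 0 := by
  obtain ⟨n, w, w', hw, rfl⟩ : ∃ (n : ℕ) (w w' : ℂ⟦X⟧), w * w' = 1 ∧ W = X ^ n * w := by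
    refine ⟨W.order.toNat, Unit_of_divided_by_X_pow_order W,
      ↑(Unit_of_divided_by_X_pow_order W)⁻¹, Units.mul_inv _, ?_⟩
    rw [Unit_of_divided_by_X_pow_order_nonzero hW0, X_pow_order_mul_divXPowOrder]
  obtain ⟨Q, rfl⟩ : ∃ Q, Z = w * Q := ⟨w' * Z, by rw [← mul_assoc, hw, one_mul]⟩
  have hw0 : w ≠ 0 := left_ne_zero_of_mul_eq_one hw
  have hX : X ^ 2 * derivative ℂ (X ^ n : ℂ⟦X⟧) = (n : ℂ⟦X⟧) * X * X ^ n := by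
    rcases n with _ | n
    · simp
    · rw [Derivation.leibniz_pow, derivative_X, Nat.add_sub_cancel, nsmul_eq_mul, smul_eq_mul]
      ring
  -- Writing `W = b ^ n w` and `Z = w Q` with `w` a unit eliminates `T`. In degree `n + p + 1` both
  -- terms in `Q` have coefficient `(n + p) Q_{n+p}`, so the term in `s` must vanish.
  have key : X ^ 2 * derivative ℂ Q = (n + p : ℂ⟦X⟧) * X * Q + s * X ^ n := by
    have hne : w * w * X ^ n ≠ 0 := mul_ne_zero (mul_ne_zero hw0 hw0) (pow_ne_zero _ X_ne_zero)
    apply mul_left_cancel₀ hne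
    simp only [Derivation.leibniz, smul_eq_mul, map_add, map_natCast] at hW hZ
    linear_combination (X ^ n * w) * hZ - (w * Q) * hW + w * w * Q * hX
  have h := congrArg (coeff (n + p + 1)) key
  have e1 : coeff (n + p + 1) (X ^ 2 * derivative ℂ Q) = coeff (n + p) Q * (n + p) := by
    rw [coeff_X_pow_mul']
    rcases hnp : n + p with _ | m
    · have : (n : ℂ) + p = 0 := by exact_mod_cast hnp
      simp [this]
    · have : (n : ℂ) + p = m + 1 := by exact_mod_cast hnp
      rw [if_pos (by omega), show m + 1 + 1 - 2 = m by omega, coeff_derivative, this]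
  have e2 : coeff (n + p + 1) ((n + p : ℂ⟦X⟧) * X * Q) = coeff (n + p) Q * (n + p) := by
    have : (n + p : ℂ⟦X⟧) = C ((n : ℂ) + p) := by simp
    rw [this, mul_assoc, coeff_C_mul, coeff_succ_X_mul, mul_comm]
  have e3 : coeff (n + p + 1) (s * X ^ n) = coeff (p + 1) s := by
    rw [show n + p + 1 = (p + 1) + n by ring, coeff_mul_X_pow]
  rw [map_add, e1, e2, e3] at h
  simpa using h

/-- The equation for `U` reads `(c₁ - c₂ - 1 + n) U_n = -s_n` degree by degree. It is solvable once
`s_n = 0` at the possible resonant degree, and `U_0 ≠ 0` because `s_0 ≠ 0`. -/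
theorem IsStep.exists_swap {F₀ F₁ F₂ : Submodule ℂ⟦X⟧ E} {e₁ e₂ : E} {c₁ c₂ : ℂ}
    (h1 : IsStep F₀ F₁ e₁ c₁) (h2 : IsStep F₁ F₂ e₂ c₂) (hF : AStable F₀) (hsep : Separated F₀)
    {s : ℂ⟦X⟧} (hs : AModule.a e₂ - (C c₂ * X : ℂ⟦X⟧) • e₂ - s • e₁ ∈ F₀) (hu : IsUnit s) :
    ∃ (G : Submodule ℂ⟦X⟧ E) (x y : E), IsStep F₀ G x (c₂ + 1) ∧ IsStep G F₂ y (c₁ - 1) := by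
  by_cases hc : c₂ + 1 = c₁
  -- Here `(c₂ + 1, c₁ - 1) = (c₁, c₂)`: the given chain already works.
  · subst hc
    exact ⟨F₁, e₁, e₂, h1, by simpa using h2⟩
  have hres : ∀ n : ℕ, c₁ - c₂ - 1 + n = 0 → coeff n s = 0 := by
    intro n hn
    rcases n with _ | p
    · exact absurd (by push_cast at hn; linear_combination -hn) hc
    obtain ⟨T, f, hf, hfF, hfe⟩ := hsep e₁ h1.not_mem
    have hZ := hfF _ hs
    have hcp : c₂ = c₁ + p := by push_cast at hn; linear_combination -hn
    rw [map_sub, map_sub, map_smul, map_smul, hf, smul_eq_mul, smul_eq_mul, hcp] at hZ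
    exact coeff_eq_zero_of_resonance hfe (hf.map_a_of_mem hfF h1.a_mem) (Z := f e₂)
      (by linear_combination hZ)
  set U : ℂ⟦X⟧ := PowerSeries.mk fun n => -coeff n s / (c₁ - c₂ - 1 + n) with hU
  have hsol : (C c₁ - C c₂ - 1) * U + X * derivative ℂ U + s = 0 := by
    ext n
    have e1 : coeff n (X * derivative ℂ U) = n * coeff n U := by
      rcases n with _ | n
      · simp
      · rw [coeff_succ_X_mul, coeff_derivative]; push_cast; ring
    have e2 : (C c₁ - C c₂ - 1 : ℂ⟦X⟧) = C (c₁ - c₂ - 1) := by simp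
    rw [map_add, map_add, e1, e2, coeff_C_mul, hU, coeff_mk, map_zero]
    by_cases hn : c₁ - c₂ - 1 + n = 0
    · rw [hres n hn, neg_zero, zero_div]; ring
    · field_simp
      ring
  have hUu : IsUnit U := by
    rw [isUnit_iff_constantCoeff, ← coeff_zero_eq_constantCoeff_apply, hU, coeff_mk,
      isUnit_iff_ne_zero]
    rw [isUnit_iff_constantCoeff, ← coeff_zero_eq_constantCoeff_apply, isUnit_iff_ne_zero] at hu
    refine div_ne_zero (neg_ne_zero.2 hu) fun h0 => hc ?_
    push_cast at h0
    linear_combination -h0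
  obtain ⟨V, hV⟩ := hUu.exists_right_inv
  exact h1.swap_of_solution h2 hF hs hsol hV

end Steps

/-! ### Cyclicity along a chain, and the action of permutations. -/

section Chains

variable {E : Type u} [AddCommGroup E] [Module ℂ⟦X⟧ E] [AModule E]

/-- `F = ℂ[[b]] ψ + a F + b F`. -/
def Generated (F : Submodule ℂ⟦X⟧ E) (ψ : E) : Prop :=
  ∀ z ∈ F, ∃ r : ℂ⟦X⟧, ∃ w ∈ F, ∃ u ∈ F, z = r • ψ + AModule.a w + (X : ℂ⟦X⟧) • u

/-- The coefficients along `e` in an element of `ℂ[[b]] ψ + a G + b G`. -/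
theorem IsStep.exists_decomposition {F G : Submodule ℂ⟦X⟧ E} {e : E} {c : ℂ}
    (h : IsStep F G e c) {ψ : E} (hG : Generated G ψ) {g : ℂ⟦X⟧} {z : E} (hz : z ∈ G) :
    ∃ r p q : ℂ⟦X⟧, ∃ w ∈ F, ∃ u ∈ F,
      z = r • (ψ - g • e) + AModule.a w + p • (AModule.a e - (C c * X : ℂ⟦X⟧) • e) +
        (X : ℂ⟦X⟧) • u + (r * g + X * q) • e := by
  obtain ⟨r, w, hw, u, hu, rfl⟩ := hG z hz
  obtain ⟨p, hp⟩ := h.gen w hw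
  obtain ⟨q, hq⟩ := h.gen u hu
  refine ⟨r, p, p * C c + X * derivative ℂ p + q, _, hp, _, hq, ?_⟩
  rw [map_sub, AModule.a_smul]
  module

/-- A Nakayama argument: modulo `F`, both `a G` and `b G` lie in `b ℂ[[b]] e`. Hence `e` can be
reached only if the coefficient `g` of `ψ` has nonzero constant term. -/
theorem IsStep.isUnit_of_generated {F G : Submodule ℂ⟦X⟧ E} {e : E} {c : ℂ}
    (h : IsStep F G e c) (hF : AStable F) {ψ : E} (hG : Generated G ψ) {g : ℂ⟦X⟧}
    (hg : ψ - g • e ∈ F) : IsUnit g := by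
  obtain ⟨r, p, q, w, hw, u, hu, hz⟩ := h.exists_decomposition hG (g := g) h.mem
  have h1 := h.free (1 - (r * g + X * q)) (by
    have := F.add_mem (F.add_mem (F.add_mem (F.smul_mem r hg) (hF w hw))
      (F.smul_mem p h.a_mem)) (F.smul_mem X hu)
    convert this using 1
    rw [sub_smul, one_smul]
    nth_rw 1 [hz]
    rw [add_sub_cancel_right])
  have h2 := congrArg constantCoeff h1
  simp only [map_sub, map_add, map_mul, constantCoeff_X, zero_mul, add_zero, map_one,
    map_zero] at h2
  rw [isUnit_iff_constantCoeff, isUnit_iff_ne_zero]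
  intro h0
  simp [h0] at h2

/-- For an element of `F` the coefficient `r g + b q` along `e` is zero, so `b` divides `r` as `g`
is a unit. The contribution `r (ψ - g e)` is then absorbed in `b F`, leaving `(a - c b) e` as
generator. -/
theorem IsStep.generated {F G : Submodule ℂ⟦X⟧ E} {e : E} {c : ℂ}
    (h : IsStep F G e c) (hF : AStable F) {ψ : E} (hψ : ψ ∈ G) (hG : Generated G ψ) :
    Generated F (AModule.a e - (C c * X : ℂ⟦X⟧) • e) := by
  intro z hz
  obtain ⟨g, hg⟩ := h.gen ψ hψ
  obtain ⟨g', hg'⟩ := (h.isUnit_of_generated hF hG hg).exists_right_inv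
  obtain ⟨r, p, q, w, hw, u, hu, hz'⟩ := h.exists_decomposition hG (g := g) (h.le hz)
  have h1 : r * g + X * q = 0 := h.free _ (by
    have := F.sub_mem hz (F.add_mem (F.add_mem (F.add_mem (F.smul_mem r hg) (hF w hw))
      (F.smul_mem p h.a_mem)) (F.smul_mem X hu))
    convert this using 1
    nth_rw 1 [hz']
    rw [add_sub_cancel_left])
  have h2 : r = X * (-(q * g')) := by linear_combination g' * h1 - r * hg'
  refine ⟨p, w, hw, u + (-(q * g')) • (ψ - g • e), F.add_mem hu (F.smul_mem _ hg), ?_⟩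
  rw [hz', h1, zero_smul, add_zero, smul_add, smul_smul, ← h2]
  abel

/-- A chain of submodules from `0` to `E`, with the `j`-th quotient isomorphic to `E_{ν j}`. -/
structure IsChain (k : ℕ) (F : ℕ → Submodule ℂ⟦X⟧ E) (e : ℕ → E) (ν : ℕ → ℂ) : Prop where
  zero : F 0 = ⊥
  last : F k = ⊤
  step : ∀ j < k, IsStep (F j) (F (j + 1)) (e j) (ν j)

namespace IsChain

variable {k : ℕ} {F : ℕ → Submodule ℂ⟦X⟧ E} {e : ℕ → E} {ν : ℕ → ℂ}

theorem aStable (h : IsChain k F e ν) {j : ℕ} (hj : j ≤ k) : AStable (F j) := by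
  induction j with
  | zero =>
    intro x hx
    rw [h.zero, Submodule.mem_bot] at hx ⊢
    rw [hx, map_zero]
  | succ j ih => exact (h.step j (by omega)).aStable (ih (by omega))

theorem saturated (h : IsChain k F e ν) {j : ℕ} (hj : j ≤ k) (W : ℂ⟦X⟧) (x : E) (hW : W ≠ 0)
    (hx : W • x ∈ F j) : x ∈ F j := by
  -- Descends from `F k = ⊤`, one torsion-free quotient at a time.
  have key : ∀ i, j + i ≤ k → x ∈ F (j + i) → x ∈ F j := by
    intro i
    induction i with
    | zero => exact fun _ h => h
    | succ i ih =>
      intro hi hxi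
      have le : ∀ m, j + m ≤ k → F j ≤ F (j + m) := by
        intro m
        induction m with
        | zero => exact fun _ => le_rfl
        | succ m ihm => exact fun hm => (ihm (by omega)).trans (h.step (j + m) (by omega)).le
      exact ih (by omega) ((h.step (j + i) (by omega)).saturated hW hxi (le i (by omega) hx))
  refine key (k - j) (by omega) ?_
  rw [show j + (k - j) = k by omega, h.last]
  trivial

theorem separated (h : IsChain k F e ν) (hE : Separated (⊥ : Submodule ℂ⟦X⟧ E)) {j : ℕ}
    (hj : j ≤ k) : Separated (F j) := by
  induction j with
  | zero => rwa [h.zero]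
  | succ j ih => exact (ih (by omega)).of_step (h.step j (by omega)) (h.saturated hj)

/-- Cyclicity passes from `E = F k` down the chain, with an explicit generator at each stage. -/
theorem generated (h : IsChain k F e ν) {ψ : E} (hψ : Generated ⊤ ψ) {j : ℕ} (hj : j < k) :
    Generated (F j) (AModule.a (e j) - (C (ν j) * X : ℂ⟦X⟧) • e j) := by
  have key : ∀ i j, j + i = k → ∃ φ ∈ F j, Generated (F j) φ := by
    intro i
    induction i with
    | zero =>
      intro j hj
      obtain rfl : j = k := hj
      rw [h.last]
      exact ⟨ψ, trivial, hψ⟩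
    | succ i ih =>
      intro j hj
      obtain ⟨φ, hφ, hg⟩ := ih (j + 1) (by omega)
      have st := h.step j (by omega)
      exact ⟨_, st.a_mem, st.generated (h.aStable (by omega)) hφ hg⟩
  obtain ⟨φ, hφ, hg⟩ := key (k - (j + 1)) (j + 1) (by omega)
  exact (h.step j hj).generated (h.aStable hj.le) hφ hg

theorem exists_swap (h : IsChain k F e ν) (hE : Separated (⊥ : Submodule ℂ⟦X⟧ E)) {ψ : E}
    (hψ : Generated ⊤ ψ) {i : ℕ} (hi : i + 1 < k) :
    ∃ (F' : ℕ → Submodule ℂ⟦X⟧ E) (e' : ℕ → E) (ν' : ℕ → ℂ), IsChain k F' e' ν' ∧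
      ν' i = ν (i + 1) + 1 ∧ ν' (i + 1) = ν i - 1 ∧ ∀ j, j ≠ i → j ≠ i + 1 → ν' j = ν j := by
  have s1 := h.step i (by omega)
  have s2 := h.step (i + 1) hi
  obtain ⟨s, hs⟩ := s1.gen _ s2.a_mem
  -- `F (i + 1)` is generated by `(a - ν_{i+1} b) e_{i+1}`, whose coefficient along `e_i` is `s`.
  have hu := s1.isUnit_of_generated (h.aStable (by omega)) (h.generated hψ hi) hs
  obtain ⟨G, x, y, t1, t2⟩ :=
    s1.exists_swap s2 (h.aStable (by omega)) (h.separated hE (by omega)) hs hu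
  refine ⟨Function.update F (i + 1) G, Function.update (Function.update e i x) (i + 1) y,
    Function.update (Function.update ν i (ν (i + 1) + 1)) (i + 1) (ν i - 1), ⟨?_, ?_, ?_⟩,
    by simp, by simp, fun j h1 h2 => by simp [h1, h2]⟩
  · rw [Function.update_of_ne (by omega), h.zero]
  · rw [Function.update_of_ne (by omega), h.last]
  · intro j hj
    by_cases h1 : j = i
    · subst h1
      simpa using t1
    by_cases h2 : j = i + 1
    · subst h2
      simpa using t2
    have h3 : j + 1 ≠ i + 1 := by omega
    simpa [Function.update_of_ne, h1, h2, h3] using h.step j hj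

end IsChain

/-- `E` has a chain whose numbers are the `κ j - (j + 1)`. -/
def HasChain (E : Type u) [AddCommGroup E] [Module ℂ⟦X⟧ E] [AModule E] {k : ℕ} (κ : Fin k → ℂ) :
    Prop :=
  ∃ (F : ℕ → Submodule ℂ⟦X⟧ E) (e : ℕ → E) (ν : ℕ → ℂ), IsChain k F e ν ∧
    ∀ j : Fin k, ν j = κ j - ((j : ℕ) + 1)

/-- The shift by `j + 1` turns `(c₁, c₂) ↦ (c₂ + 1, c₁ - 1)` into a plain transposition. -/
theorem HasChain.comp_swap (hE : Separated (⊥ : Submodule ℂ⟦X⟧ E)) {ψ : E}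
    (hψ : Generated ⊤ ψ) {n : ℕ} {κ : Fin (n + 1) → ℂ} (h : HasChain E κ) (i : Fin n) :
    HasChain E (κ ∘ Equiv.swap i.castSucc i.succ) := by
  obtain ⟨F, e, ν, hF, hν⟩ := h
  obtain ⟨F', e', ν', hF', h1, h2, h3⟩ := hF.exists_swap hE hψ (i := i) (by omega)
  have k1 : ν i = κ i.castSucc - ((i : ℕ) + 1) := hν i.castSucc
  have k2 : ν (i + 1) = κ i.succ - (((i : ℕ) + 1 : ℕ) + 1) := hν i.succ
  refine ⟨F', e', ν', hF', fun j => ?_⟩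
  by_cases hj : j = i.castSucc
  · subst hj
    rw [Function.comp_apply, Equiv.swap_apply_left, Fin.val_castSucc, h1, k2]
    push_cast; ring
  by_cases hj' : j = i.succ
  · subst hj'
    rw [Function.comp_apply, Equiv.swap_apply_right, Fin.val_succ, h2, k1]
    push_cast; ring
  rw [Function.comp_apply, Equiv.swap_apply_of_ne_of_ne hj hj', ← hν]
  refine h3 _ (fun h => hj (Fin.ext h)) (fun h => hj' (Fin.ext h))

theorem HasChain.comp_perm (hE : Separated (⊥ : Submodule ℂ⟦X⟧ E)) {ψ : E}
    (hψ : Generated ⊤ ψ) {k : ℕ} {κ : Fin k → ℂ} (h : HasChain E κ) (s : Equiv.Perm (Fin k)) :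
    HasChain E (κ ∘ s) := by
  cases k with
  | zero => rwa [Subsingleton.elim (κ ∘ s) κ]
  | succ n =>
    have hs : s ∈ Submonoid.closure
        (Set.range fun i : Fin n => Equiv.swap i.castSucc i.succ) := by
      rw [Equiv.Perm.mclosure_swap_castSucc_succ]; trivial
    induction hs using Submonoid.closure_induction generalizing κ with
    | mem x hx =>
      obtain ⟨i, rfl⟩ := hx
      exact h.comp_swap hE hψ i
    | one => exact h
    -- `κ ∘ (x * y) = (κ ∘ x) ∘ y`, so `x` acts before `y`; this is why `κ` is generalized.
    | mul x y _ _ hx hy => exact hy (hx h)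

end Chains

/-! ### From Jordan–Hölder sequences, semi-simplicity and frescos to chains, and back. -/

section Conversion

variable {E : Type u} [AddCommGroup E] [Module ℂ⟦X⟧ E] [AModule E]

theorem iso_rankOne_iff {M : Type u} [AddCommGroup M] [Module ℂ⟦X⟧ M] [AModule M] {c : ℂ} :
    Iso M (RankOne c) ↔ ∃ φ : M ≃ₗ[ℂ⟦X⟧] ℂ⟦X⟧,
      ∀ x, φ (AModule.a x) = C c * X * φ x + X ^ 2 * derivative ℂ (φ x) :=
  Iff.rfl

theorem exists_isStep_of_iso {F G : Sub E} (hFG : F.toSubmodule ≤ G.toSubmodule) {c : ℂ}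
    (h : Iso (G.toSubmodule ⧸ (F.within G).toSubmodule) (RankOne c)) :
    ∃ e : E, IsStep F.toSubmodule G.toSubmodule e c := by
  obtain ⟨φ, hφ⟩ := iso_rankOne_iff.1 h
  -- `e` lifts the generator `1` of `E_c`, which satisfies `a 1 = c b 1`.
  obtain ⟨⟨e, he⟩, hv⟩ := Submodule.Quotient.mk_surjective _ (φ.symm 1)
  let p := (F.within G).toSubmodule
  have hone : φ (Submodule.Quotient.mk (p := p) ⟨e, he⟩) = (1 : ℂ⟦X⟧) := by
    exact (congrArg φ hv).trans (φ.apply_symm_apply 1)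
  have memF : ∀ x : G.toSubmodule, φ (Submodule.Quotient.mk (p := p) x) = 0 ↔
      (x : E) ∈ F.toSubmodule := by
    intro x
    exact (φ.map_eq_zero_iff).trans (Submodule.Quotient.mk_eq_zero p)
  have smul_e : ∀ S : ℂ⟦X⟧, φ (Submodule.Quotient.mk (p := p) (S • ⟨e, he⟩)) = S := by
    intro S
    exact (φ.map_smul S _).trans ((congrArg (S * ·) hone).trans (mul_one S))
  refine ⟨e, hFG, he, fun x hx => ?_, fun S hS => ?_, ?_⟩
  · refine ⟨φ (Submodule.Quotient.mk (p := p) ⟨x, hx⟩), ?_⟩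
    refine (memF (⟨x, hx⟩ - φ (Submodule.Quotient.mk (p := p) ⟨x, hx⟩) • ⟨e, he⟩)).1 ?_
    exact (φ.map_sub (Submodule.Quotient.mk (p := p) ⟨x, hx⟩) _).trans
      (sub_eq_zero.2 (smul_e _).symm)
  · have := (memF (S • ⟨e, he⟩)).2 hS
    exact (smul_e S).symm.trans this
  · refine (memF (AModule.a (⟨e, he⟩ : G.toSubmodule) - (C c * X : ℂ⟦X⟧) • ⟨e, he⟩)).1 ?_
    have h1 := hφ (Submodule.Quotient.mk (p := p) ⟨e, he⟩)
    rw [hone, mul_one, Derivation.map_one_eq_zero, mul_zero, add_zero] at h1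
    exact (φ.map_sub _ _).trans (sub_eq_zero.2 (h1.trans (smul_e _).symm))

theorem IsStep.iso {F G : Sub E} {e : E} {c : ℂ}
    (h : IsStep F.toSubmodule G.toSubmodule e c) :
    Iso (G.toSubmodule ⧸ (F.within G).toSubmodule) (RankOne c) := by
  let p := (F.within G).toSubmodule
  let v : G.toSubmodule := ⟨e, h.mem⟩
  have memF : ∀ x : G.toSubmodule, Submodule.Quotient.mk (p := p) x = 0 ↔
      (x : E) ∈ F.toSubmodule := by
    intro x
    rw [Submodule.Quotient.mk_eq_zero]
    rfl
  let f : ℂ⟦X⟧ →ₗ[ℂ⟦X⟧] (G.toSubmodule ⧸ p) :=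
    LinearMap.toSpanSingleton ℂ⟦X⟧ _ (Submodule.Quotient.mk (p := p) v)
  have hf : ∀ S, f S = Submodule.Quotient.mk (p := p) (S • v) := fun S => rfl
  have bij : Function.Bijective f := by
    constructor
    · rw [injective_iff_map_eq_zero]
      intro S hS
      exact h.free S ((memF (S • v)).1 hS)
    · intro y
      obtain ⟨x, rfl⟩ := Submodule.Quotient.mk_surjective _ y
      obtain ⟨S, hS⟩ := h.gen x x.2
      refine ⟨S, ?_⟩
      rw [hf, eq_comm, ← sub_eq_zero, ← Submodule.Quotient.mk_sub]
      exact (memF (x - S • v)).2 hS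
  have hcomm : ∀ S : ℂ⟦X⟧, AModule.a (f S) = f (C c * X * S + X ^ 2 * derivative ℂ S) := by
    intro S
    have e2 : AModule.a (f S) = Submodule.Quotient.mk (p := p) (AModule.a (S • v)) := rfl
    rw [e2, hf, ← sub_eq_zero, ← Submodule.Quotient.mk_sub]
    refine (memF _).2 ?_
    have e3 : ((AModule.a (S • v) - (C c * X * S + X ^ 2 * derivative ℂ S) • v : G.toSubmodule) :
        E) = AModule.a (S • e) - (C c * X * S + X ^ 2 * derivative ℂ S) • e := rfl
    rw [e3, AModule.a_smul]
    have := F.toSubmodule.smul_mem S h.a_mem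
    convert this using 1
    module
  let φ := LinearEquiv.ofBijective f bij
  refine iso_rankOne_iff.2 ⟨φ.symm, fun x => ?_⟩
  rw [LinearEquiv.symm_apply_eq]
  refine Eq.trans ?_ (hcomm (φ.symm x))
  exact congrArg AModule.a (φ.apply_symm_apply x).symm

theorem Iso.finrank_eq_one {M : Type u} [AddCommGroup M] [Module ℂ⟦X⟧ M] [AModule M] {c : ℂ}
    (h : Iso M (RankOne c)) : Module.finrank ℂ⟦X⟧ M = 1 := by
  obtain ⟨φ, -⟩ := iso_rankOne_iff.1 h
  exact φ.finrank_eq.trans (Module.finrank_self ℂ⟦X⟧)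

theorem hasChain_of_isJordanHolder {k : ℕ} {F : Fin (k + 1) → Sub E} {l : Fin k → ℂ}
    (hF : IsJordanHolder F) (hl : HasNumbers F l) :
    HasChain E fun j : Fin k => l j + ((j : ℕ) + 1) := by
  choose e he using fun j => exists_isStep_of_iso (hF.le_succ j) (hl j)
  refine ⟨fun j => if h : j < k + 1 then (F ⟨j, h⟩).toSubmodule else ⊤,
    fun j => if h : j < k then e ⟨j, h⟩ else 0, fun j => if h : j < k then l ⟨j, h⟩ else 0,
    ⟨?_, ?_, fun j hj => ?_⟩, fun j => by simp⟩
  · rw [dif_pos (by omega)]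
    exact hF.zero
  · rw [dif_pos (by omega)]
    exact hF.last
  · have h1 : j < k + 1 := by omega
    have h2 : j + 1 < k + 1 := by omega
    rw [dif_pos h1, dif_pos h2, dif_pos hj, dif_pos hj]
    exact he ⟨j, hj⟩

theorem HasChain.exists_isJordanHolder {k : ℕ} {m : Fin k → ℂ}
    (h : HasChain E fun j : Fin k => m j + ((j : ℕ) + 1)) :
    ∃ G : Fin (k + 1) → Sub E, IsJordanHolder G ∧ HasNumbers G m := by
  obtain ⟨F, e, ν, hF, hν⟩ := h
  let G : Fin (k + 1) → Sub E := fun j => ⟨F j, hF.aStable (by omega)⟩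
  have hst : ∀ j : Fin k, IsStep (G j.castSucc).toSubmodule (G j.succ).toSubmodule (e j) (m j) := by
    intro j
    have := hF.step j j.2
    rwa [hν j, add_sub_cancel_right] at this
  refine ⟨G, ⟨hF.zero, hF.last, fun j => (hst j).le, fun j => ?_,
    fun j => (hst j).iso.finrank_eq_one⟩, fun j => (hst j).iso⟩
  -- Normality is saturation with respect to the single scalar `b`.
  ext x
  rw [Submodule.mem_inf, Submodule.mem_smul_pointwise_iff_exists,
    Submodule.mem_smul_pointwise_iff_exists]
  constructor
  · rintro ⟨hx, y, -, rfl⟩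
    exact ⟨y, hF.saturated (by omega) X y X_ne_zero hx, rfl⟩
  · rintro ⟨y, hy, rfl⟩
    exact ⟨(G j).toSubmodule.smul_mem X hy, y, trivial, rfl⟩

/-- A nonzero vector has a nonzero component in some rank one summand. The coordinate of that
component on a basis vector `B 0` is the morphism, and `T` is the coordinate of `a (B 0)`. -/
theorem IsSemisimple.separated_bot (h : IsSemisimple E) :
    Separated (⊥ : Submodule ℂ⟦X⟧ E) := by
  obtain ⟨n, M, _, _, _, hM, f, hf, hfa⟩ := h
  intro x hx
  have hfx : f x ≠ 0 := fun h0 => hx ((Submodule.mem_bot _).2 (hf (h0.trans (map_zero f).symm)))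
  obtain ⟨i, hi⟩ := Function.ne_iff.1 hfx
  obtain ⟨⟨⟨_, _⟩, -⟩, hr⟩ := hM i
  let B : Module.Basis (Fin 1) ℂ⟦X⟧ (M i) := Module.finBasisOfFinrankEq _ _ hr
  have hB : ∀ y : M i, y = B.repr y 0 • B 0 := by
    intro y
    conv_lhs => rw [← B.sum_repr y]
    simp
  refine ⟨B.repr (AModule.a (B 0)) 0, B.coord 0 ∘ₗ LinearMap.proj i ∘ₗ f, fun z => ?_,
    fun y hy => ?_, fun h0 => hi ?_⟩
  · have h1 : f (AModule.a z) i = AModule.a (f z i) := congrFun (hfa z) i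
    simp only [LinearMap.comp_apply, LinearMap.proj_apply, Module.Basis.coord_apply, h1]
    conv_lhs => rw [hB (f z i), AModule.a_smul]
    simp only [map_add, map_smul, Finsupp.add_apply, Finsupp.smul_apply, smul_eq_mul,
      Module.Basis.repr_self, Finsupp.single_eq_same]
    ring
  · rw [(Submodule.mem_bot _).1 hy, map_zero]
  · rw [hB (f x i)]
    have : B.repr (f x i) 0 = 0 := h0
    rw [this, zero_smul]
    rfl

theorem IsFresco.exists_generated (h : IsFresco E) :
    ∃ ψ : E, Generated (⊤ : Submodule ℂ⟦X⟧ E) ψ := by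
  obtain ⟨L, N, V, _, _, _, φ, θ, hθ⟩ := h
  have hφ : φ ∈ (cyclic φ).toSubmodule := Submodule.mem_sInf.2 fun F hF => hF.1
  let ψ : E := θ.symm ⟨φ, hφ⟩
  have htop : ∀ H : Submodule ℂ⟦X⟧ E, ψ ∈ H → AStable H → ∀ z, z ∈ H := by
    intro H h1 h2 z
    -- The image of `H` in `Ξ ⊗ V` contains `φ` and is stable under `a`, so minimality of `cyclic φ`
    -- applies.
    have hle : (cyclic φ).toSubmodule ≤
        (H.map θ.toLinearMap).map (cyclic φ).toSubmodule.subtype := by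
      refine sInf_le ⟨⟨⟨φ, hφ⟩, ⟨ψ, h1, θ.apply_symm_apply _⟩, rfl⟩, ?_⟩
      rintro _ ⟨_, ⟨y, hy, rfl⟩, rfl⟩
      exact ⟨_, ⟨AModule.a y, h2 y hy, rfl⟩, congrArg Subtype.val (hθ y)⟩
    obtain ⟨_, ⟨y, hy, rfl⟩, hyz⟩ := hle (θ z).2
    rwa [← θ.injective (Subtype.ext hyz)]
  refine ⟨ψ, fun z _ => ?_⟩
  -- `ℂ[[b]] ψ + a E + b E` is a `ℂ[[b]]`-submodule because `S a w = a (S w) - b ^ 2 S' w`. It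
  -- contains `ψ` and all of `a E`, hence is everything.
  let H : Submodule ℂ⟦X⟧ E :=
    { carrier := {z | ∃ (r : ℂ⟦X⟧) (w u : E), z = r • ψ + AModule.a w + (X : ℂ⟦X⟧) • u}
      zero_mem' := ⟨0, 0, 0, by simp⟩
      add_mem' := by
        rintro _ _ ⟨r, w, u, rfl⟩ ⟨r', w', u', rfl⟩
        refine ⟨r + r', w + w', u + u', ?_⟩
        rw [map_add]
        module
      smul_mem' := by
        rintro S _ ⟨r, w, u, rfl⟩
        refine ⟨S * r, S • w, S • u - (X * derivative ℂ S) • w, ?_⟩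
        rw [AModule.a_smul]
        module }
  obtain ⟨r, w, u, hz⟩ := htop H ⟨1, 0, 0, by simp⟩ (fun x _ => ⟨0, x, 0, by simp⟩) z
  exact ⟨r, w, trivial, u, trivial, hz⟩

end Conversion

end Fresco

end

theorem lemma2p4p2 {E : Type*} [AddCommGroup E] [Module (PowerSeries ℂ) E] [Fresco.AModule E]
    (hE : Fresco.IsFresco E) (hss : Fresco.IsSemisimple E)
    {k : ℕ} (F : Fin (k + 1) → Fresco.Sub E) (l : Fin k → ℂ)
    (hF : Fresco.IsJordanHolder F) (hl : Fresco.HasNumbers F l)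
    (m : Fin k → ℂ) (hm : Fresco.IsTwistedPermutation l m) :
    ∃ G : Fin (k + 1) → Fresco.Sub E, Fresco.IsJordanHolder G ∧ Fresco.HasNumbers G m := by
  obtain ⟨ψ, hψ⟩ := hE.exists_generated
  obtain ⟨s, hs⟩ := hm
  have h := (Fresco.hasChain_of_isJordanHolder hF hl).comp_perm hss.separated_bot hψ s
  refine Fresco.HasChain.exists_isJordanHolder ?_
  convert h using 2 with j
  exact hs j
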